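/- Let $N\in\mathbb N$, $\chi>0$, and for $\ell=1,\dots,N$ let $m^\ell>0$ (mass), $q^\ell\in\mathbb R$ (charge) and $a^\ell>0$ (size parameter). For $a>0$ let $G_a$ be the logarithmic nonlinearity $$G_a(s)=\int_0^s G_a'(u)\,\mathrm du,\qquad G_a'(s)=-a^{-2}\ln\!\big(a^3 s/C_g^2\big)-3a^{-2},\qquad C_g=\pi^{-3/4},$$ with the convention $G_a'(|\psi|^2)\psi=0$ where $\psi=0$. Let $\Xi=\{\psi\in H^1(\mathbb R^3;\mathbb C):\int|\psi|^2\,\mathrm dx=1\}$. For $\{\psi_\ell\}_{\ell=1}^N\in\Xi^N$ put $$\varphi_\ell(x)=q^\ell\int_{\mathbb R^3}\frac{|\psi_\ell(y)|^2}{|y-x|}\,\mathrm dy,\qquad \varphi_{\neq\ell}=\sum_{\ell'\neq\ell}\varphi_{\ell'}$$ (so that $\nabla^2\varphi_\ell=-4\pi q^\ell|\psi_\ell|^2$). We say that $\{\psi_\ell\}\in\Xi^N$ is a multiharmonic solution with frequencies $\{\omega_\ell\}\in\mathbb R^N$ if for every $\ell$, in the weak sense (tested against $C_c^\infty(\mathbb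 R^3)$), $$\chi\omega_\ell\psi_\ell+\frac{\chi^2}{2m^\ell}\nabla^2\psi_\ell-q^\ell\varphi_{\neq\ell}\psi_\ell-\frac{\chi^2}{2m^\ell}G_{a^\ell}'\big(|\psi_\ell|^2\big)\psi_\ell=0 .$$ The energy of the $\ell$-th particle in the field of the system is $$\mathsf E_{0\ell}=\int q^\ell|\psi_\ell|^2\varphi_{\neq\ell}\,\mathrm dx+\int\frac{\chi^2}{2m^\ell}\Big\{|\nabla\psi_\ell|^2+G_{a^\ell}\big(|\psi_\ell|^2\big)\Big\}\,\mathrm dx ;$$ it is called finite if both integrals converge absolutely. **Theorem.** Let $\{\psi_\ell\},\{\psi_\ell'\}\in\Xi^N$ be two multiharmonic solutions, with frequencies $\{\omega_\ell\}$, $\{\omega_\ell'\}$ and finite energies $\{\mathsf E_{0\ell}\}$, $\{\mathsf E_{0\ell}'\}$. Then for every $\ell=1,\dots,N$ $$\chi\omega_\ell-\mathsf E_{0\ell}=\chi\omega_\ell'-\mathsf E_{0\ell}'=-\frac{\chi^2}{2(a^\ell)^2m^\ell},$$ and hence the Planck–Einstein relation holds: $$\chi(\omega_\ell-\omega_\ell')=\mathsf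 E_{0\ell}-\mathsf E_{0\ell}',\qquad \ell=1,\dots,N .$$ -/

import Mathlib

open MeasureTheory

noncomputable section

namespace Charges

/-- Physical space `ℝ³` with its Euclidean norm. -/
abbrev Space : Type := EuclideanSpace ℝ (Fin 3)

/-- The partial derivative `∂_j η` of a complex function on `ℝ³`. -/
def partialDeriv (j : Fin 3) (η : Space → ℂ) (x : Space) : ℂ :=
  fderiv ℝ η x (EuclideanSpace.single j 1)

/-- Test functions: complex-valued, smooth, with compact support in `ℝ³`. -/
def IsTestFunction (η : Space → ℂ) : Prop :=
  ContDiff ℝ ((⊤ : ℕ∞) : WithTop ℕ∞) η ∧ HasCompactSupport η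

/-- `g` is a square integrable weak gradient of `ψ`. -/
def IsWeakGradient (ψ : Space → ℂ) (g : Space → EuclideanSpace ℂ (Fin 3)) : Prop :=
  MemLp g 2 volume ∧
    ∀ η : Space → ℂ, IsTestFunction η → ∀ j : Fin 3,
      ∫ x, ψ x * partialDeriv j η x = -∫ x, g x j * η x

/-- The Sobolev space `H¹(ℝ³)` of complex functions: `ψ ∈ L²` with weak gradient in `L²`. -/
def MemH1 (ψ : Space → ℂ) : Prop :=
  MemLp ψ 2 volume ∧ ∃ g, IsWeakGradient ψ g

open Classical in
/-- The weak gradient `∇ψ` (unique up to a null set for `ψ ∈ H¹`). -/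
def weakGradient (ψ : Space → ℂ) : Space → EuclideanSpace ℂ (Fin 3) :=
  if h : ∃ g, IsWeakGradient ψ g then h.choose else 0

/-- The set `Ξ` of all `ψ ∈ H¹(ℝ³)` with `∫ |ψ|² = 1`. -/
def MemXi (ψ : Space → ℂ) : Prop :=
  MemH1 ψ ∧ ∫ x, ‖ψ x‖ ^ 2 = 1

/-- The constant `C_g = π^{-3/4}` of the Gaussian form factor. -/
def gaussConst : ℝ := Real.pi ^ (-(3 / 4) : ℝ)

/-- The derivative of the logarithmic nonlinearity of size `a`:
`G_a'(s) = -a⁻² ln (a³ s / C_g²) - 3 a⁻²`. Its value at `s = 0` only ever occurs multiplied by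
`0`, in accordance with the convention `G_a'(|ψ|²) ψ = 0` where `ψ = 0`. -/
def logG' (a s : ℝ) : ℝ :=
  -(a ^ 2)⁻¹ * Real.log (a ^ 3 * s / gaussConst ^ 2) - 3 * (a ^ 2)⁻¹

/-- The logarithmic nonlinearity of size `a`: `G_a(s) = ∫₀ˢ G_a'(u) du`. -/
def logG (a s : ℝ) : ℝ := ∫ u in (0 : ℝ)..s, logG' a u

/-- The potential of the charge `q` with wave function `ψ`, the solution vanishing at infinity of
`∇²φ = -4π q |ψ|²`, namely `φ(x) = q ∫ |ψ(y)|² / |y - x| dy`. -/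
def potential (q : ℝ) (ψ : Space → ℂ) (x : Space) : ℝ :=
  q * ∫ y, ‖ψ y‖ ^ 2 / ‖y - x‖

/-- `φ_{≠ℓ} = ∑_{k ≠ ℓ} φ_k`, the potential of all charges other than the `ℓ`-th. -/
def otherPotential {N : ℕ} (q : Fin N → ℝ) (ψ : Fin N → Space → ℂ) (l : Fin N) (x : Space) : ℝ :=
  ∑ k ∈ Finset.univ.erase l, potential (q k) (ψ k) x

/-- `(ψ_ℓ)` in `Ξ^N` is a weak solution, with the frequencies `(ω_ℓ)`, of the nonlinear
eigenvalue problem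
`χ ω_ℓ ψ_ℓ + χ²/(2 m_ℓ) ∇²ψ_ℓ - q_ℓ φ_{≠ℓ} ψ_ℓ - χ²/(2 m_ℓ) G_{a_ℓ}'(|ψ_ℓ|²) ψ_ℓ = 0`
for every `ℓ`. -/
structure IsMultiharmonicSolution {N : ℕ} (χ : ℝ) (m q a : Fin N → ℝ)
    (ψ : Fin N → Space → ℂ) (ω : Fin N → ℝ) : Prop where
  memXi : ∀ l, MemXi (ψ l)
  equation : ∀ l, ∀ η : Space → ℂ, IsTestFunction η →
    ∫ x, (((χ * ω l : ℝ) : ℂ) * ψ l x * η x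
      - ((χ ^ 2 / (2 * m l) : ℝ) : ℂ) *
          ∑ j : Fin 3, weakGradient (ψ l) x j * partialDeriv j η x
      - ((q l * otherPotential q ψ l x : ℝ) : ℂ) * ψ l x * η x
      - ((χ ^ 2 / (2 * m l) * logG' (a l) (‖ψ l x‖ ^ 2) : ℝ) : ℂ) * ψ l x * η x) = 0

/-- The energy of the `ℓ`-th particle in the field of the system:
`E_{0ℓ} = ∫ q_ℓ |ψ_ℓ|² φ_{≠ℓ} dx + ∫ χ²/(2 m_ℓ) (|∇ψ_ℓ|² + G_{a_ℓ}(|ψ_ℓ|²)) dx`. -/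
def particleEnergy {N : ℕ} (χ : ℝ) (m q a : Fin N → ℝ) (ψ : Fin N → Space → ℂ)
    (l : Fin N) : ℝ :=
  (∫ x, q l * ‖ψ l x‖ ^ 2 * otherPotential q ψ l x) +
    ∫ x, χ ^ 2 / (2 * m l) * (‖weakGradient (ψ l) x‖ ^ 2 + logG (a l) (‖ψ l x‖ ^ 2))

/-- The energy `E_{0ℓ}` is finite: both integrals defining it converge absolutely. -/
def HasFiniteEnergy {N : ℕ} (χ : ℝ) (m q a : Fin N → ℝ) (ψ : Fin N → Space → ℂ)
    (l : Fin N) : Prop :=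
  Integrable (fun x => q l * ‖ψ l x‖ ^ 2 * otherPotential q ψ l x) volume ∧
    Integrable (fun x => χ ^ 2 / (2 * m l) *
      (‖weakGradient (ψ l) x‖ ^ 2 + logG (a l) (‖ψ l x‖ ^ 2))) volume

/-- The closed form of the logarithmic nonlinearity. -/
theorem logG_eq {a : ℝ} (ha : 0 < a) (s : ℝ) (hs : 0 ≤ s) :
    logG a s = -(a ^ 2)⁻¹ * (s * Real.log s) +
      (a ^ 2)⁻¹ * s * (Real.log (1 / Real.pi ^ (3 / 2 : ℝ)) - 2 - 3 * Real.log a) := by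
  have hpi := Real.pi_pos
  have hC : gaussConst ^ 2 = (Real.pi ^ (3 / 2 : ℝ))⁻¹ := by
    unfold gaussConst
    rw [← Real.rpow_natCast, ← Real.rpow_mul hpi.le, ← Real.rpow_neg hpi.le]
    norm_num
  have hP : 0 < Real.pi ^ (3 / 2 : ℝ) := Real.rpow_pos_of_pos hpi _
  have hval : ∀ u ∈ Set.uIoc 0 s, logG' a u =
      -(a ^ 2)⁻¹ * Real.log u +
        (a ^ 2)⁻¹ * (Real.log (1 / Real.pi ^ (3 / 2 : ℝ)) - 3 - 3 * Real.log a) := by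
    intro u hu
    rw [Set.uIoc_of_le hs] at hu
    unfold logG'
    rw [hC, div_inv_eq_mul, Real.log_mul (by have := hu.1; positivity) hP.ne',
      Real.log_mul (by positivity) hu.1.ne', Real.log_pow, one_div, Real.log_inv]
    push_cast
    ring
  unfold logG
  rw [intervalIntegral.integral_congr_ae (Filter.Eventually.of_forall hval),
    intervalIntegral.integral_add (intervalIntegral.intervalIntegrable_log'.const_mul _)
      intervalIntegrable_const, intervalIntegral.integral_const_mul, integral_log_from_zero]
  simp
  ring

end Charges

end

/-!
# The Planck–Einstein relation for multiharmonic solutions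

The `ℓ`-th equation, tested with `conj ψ_ℓ`, expresses `χ ω_ℓ` through the integrals of
`|∇ψ_ℓ|²`, `q_ℓ φ_{≠ℓ} |ψ_ℓ|²` and `G'(|ψ_ℓ|²) |ψ_ℓ|²`. For the logarithmic nonlinearity
`s G'(s) = G(s) - s / a²` (`logG_eq_logG'_mul`), so that, by `∫ |ψ_ℓ|² = 1`, this expression differs
from the energy by the constant `-χ² / (2 a_ℓ² m_ℓ)`, the same for all solutions.

The analytic content is that `conj ψ_ℓ`, which is not a test function, may be used as one. Write the
equation as `F = -κ Δu` with `u = ψ_ℓ`. Here `F` is locally integrable: the potential is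
(`locallyIntegrable_potential`), its product with `|u|²` is integrable because the energy is finite,
and `|V u| ≤ |V| (1 + |u|²)`; the logarithmic term is treated likewise, since `r log r` is bounded near
`0` (`exists_abs_logG'_sq_mul_le`). Finite energy also makes `F conj u` integrable.

Admissible test functions are `X S(ρ_n ⋆ u)`, with `X` a spatial cutoff and `S : ℂ → ℂ` smooth with
compact support. As `n → ∞` they are uniformly bounded and compactly supported, which is enough for
the term with `F`, while the gradient term is controlled by a dominated convergence theorem with
convergent majorants `|g|² + ρ_n ⋆ |g|²`, where `g = ∇u` (`integral_mul_comp_eq`). Rescaling `X` and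
`S` so that `X → 1` and `S → conj`, with `|S(w)| ≤ |w|` and bounded derivatives, ordinary dominated
convergence gives `∫ F conj u = κ ∫ |∇u|²` (`integral_mul_conj_eq`).
-/

namespace Charges

open Filter Topology Convolution ContinuousLinearMap

/-! ### Dominated convergence with convergent majorants -/

/-- Dominated convergence with dominating functions that vary with `n`: it is enough that they
converge almost everywhere and that their integrals converge to the integral of the limit. -/
theorem tendsto_integral_of_tendsto_dominated {α : Type*} [MeasurableSpace α] {μ : Measure α}
    {f : ℕ → α → ℂ} {f' : α → ℂ} {G : ℕ → α → ℝ} {G' : α → ℝ}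
    (hf : ∀ n, AEStronglyMeasurable (f n) μ) (hG : ∀ n, Integrable (G n) μ)
    (hG' : Integrable G' μ) (hle : ∀ n, ∀ᵐ x ∂μ, ‖f n x‖ ≤ G n x)
    (hlim : ∀ᵐ x ∂μ, Tendsto (fun n => f n x) atTop (𝓝 (f' x)))
    (hGlim : ∀ᵐ x ∂μ, Tendsto (fun n => G n x) atTop (𝓝 (G' x)))
    (hGint : Tendsto (fun n => ∫ x, G n x ∂μ) atTop (𝓝 (∫ x, G' x ∂μ))) :
    Tendsto (fun n => ∫ x, f n x ∂μ) atTop (𝓝 (∫ x, f' x ∂μ)) := by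
  have hf'm : AEStronglyMeasurable f' μ := aestronglyMeasurable_of_tendsto_ae atTop hf hlim
  have hle' : ∀ᵐ x ∂μ, ‖f' x‖ ≤ G' x := by
    filter_upwards [ae_all_iff.2 hle, hlim, hGlim] with x h1 h2 h3
    exact le_of_tendsto_of_tendsto' h2.norm h3 h1
  have hf'i : Integrable f' μ := hG'.mono' hf'm hle'
  have hfi : ∀ n, Integrable (f n) μ := fun n => (hG n).mono' (hf n) (hle n)
  -- Where `‖f n - f'‖ ≤ 2 G'` ordinary dominated convergence applies; since `‖f n - f'‖ ≤ G n + G'`,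
  -- the excess over `2 G'` is at most the positive part of `G n - G'`, that is
  -- `G n - min (G n) G'`, whose integral tends to `0`.
  have h1 : Tendsto (fun n => ∫ x, min ‖f n x - f' x‖ (2 * G' x) ∂μ) atTop (𝓝 0) := by
    have : (0 : ℝ) = ∫ x, (0 : ℝ) ∂μ := by simp
    rw [this]
    refine tendsto_integral_of_dominated_convergence (fun x => 2 * G' x)
      (fun n => ((hfi n).sub hf'i).norm.aestronglyMeasurable.inf
        (hG'.const_mul 2).aestronglyMeasurable) (hG'.const_mul 2) (fun n => ?_) ?_
    · filter_upwards [hle'] with x hx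
      have : 0 ≤ G' x := (norm_nonneg _).trans hx
      rw [Real.norm_of_nonneg (le_min (norm_nonneg _) (by linarith))]
      exact min_le_right _ _
    · filter_upwards [hlim, hle'] with x hx hx'
      have h0 : 0 ≤ G' x := (norm_nonneg _).trans hx'
      have := ((tendsto_iff_norm_sub_tendsto_zero.1 hx).min
        (tendsto_const_nhds (x := 2 * G' x)))
      rwa [min_eq_left (by linarith)] at this
  have h2 : Tendsto (fun n => ∫ x, min (G n x) (G' x) ∂μ) atTop (𝓝 (∫ x, G' x ∂μ)) := by
    refine tendsto_integral_of_dominated_convergence G'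
      (fun n => (hG n).aestronglyMeasurable.inf hG'.aestronglyMeasurable) hG' (fun n => ?_) ?_
    · filter_upwards [hle n, hle'] with x hx hx'
      rw [Real.norm_of_nonneg (le_min ((norm_nonneg _).trans hx) ((norm_nonneg _).trans hx'))]
      exact min_le_right _ _
    · filter_upwards [hGlim] with x hx
      simpa using hx.min (tendsto_const_nhds (x := G' x))
  have h3 := (h1.add hGint).sub h2
  rw [zero_add, sub_self] at h3
  rw [tendsto_iff_norm_sub_tendsto_zero]
  refine squeeze_zero (fun n => norm_nonneg _) (fun n => ?_) h3
  have hi1 : Integrable (fun x => min ‖f n x - f' x‖ (2 * G' x)) μ :=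
    ((hfi n).sub hf'i).norm.inf (hG'.const_mul 2)
  have hi2 : Integrable (fun x => min (G n x) (G' x)) μ := (hG n).inf hG'
  have hi3 : Integrable (fun x => min ‖f n x - f' x‖ (2 * G' x) + G n x) μ := hi1.add (hG n)
  rw [← integral_sub (hfi n) hf'i, ← integral_add hi1 (hG n), ← integral_sub hi3 hi2]
  refine (norm_integral_le_integral_norm _).trans (integral_mono_ae ((hfi n).sub hf'i).norm
    (hi3.sub hi2) ?_)
  filter_upwards [hle n, hle'] with x hx hx'
  have h := norm_sub_le (f n x) (f' x)
  rcases le_total ‖f n x - f' x‖ (2 * G' x) with h4 | h4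
  · rw [min_eq_left h4]
    linarith [min_le_left (G n x) (G' x)]
  · rw [min_eq_right h4]
    linarith [min_le_right (G n x) (G' x)]

/-! ### Mollification of functions with a weak gradient -/

/-- The mollifier of scale `1 / (n + 1)`, before normalization. The ratio of its radii does not
depend on `n`, as almost everywhere convergence of the mollifications requires. -/
noncomputable def mollifier (n : ℕ) : ContDiffBump (0 : Space) where
  rIn := 1 / ((n : ℝ) + 1)
  rOut := 2 / ((n : ℝ) + 1)
  rIn_pos := by positivity
  rIn_lt_rOut := by gcongr; norm_num

/-- The mollification `ρ_n ⋆ f`, where `ρ_n` is the normalized mollifier. -/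
noncomputable def mollify {E : Type*} [NormedAddCommGroup E] [NormedSpace ℝ E] (n : ℕ)
    (f : Space → E) : Space → E :=
  (mollifier n).normed volume ⋆[lsmul ℝ ℝ, volume] f

theorem ae_tendsto_mollify {E : Type*} [NormedAddCommGroup E] [NormedSpace ℝ E] [CompleteSpace E]
    {f : Space → E} (hf : LocallyIntegrable f volume) :
    ∀ᵐ x, Tendsto (fun n => mollify n f x) atTop (𝓝 (f x)) := by
  refine ContDiffBump.ae_convolution_tendsto_right_of_locallyIntegrable (K := 2) ?_ ?_ hf
  · exact tendsto_const_nhds.div_atTop (tendsto_natCast_atTop_atTop.atTop_add tendsto_const_nhds)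
  · refine Eventually.of_forall fun n => le_of_eq ?_
    simp only [mollifier]
    ring

theorem contDiff_mollify {f : Space → ℂ} (hf : LocallyIntegrable f volume) (n : ℕ) :
    ContDiff ℝ ((⊤ : ℕ∞) : WithTop ℕ∞) (mollify n f) :=
  (mollifier n).hasCompactSupport_normed.contDiff_convolution_left _
    (mollifier n).contDiff_normed hf

theorem mollify_convolutionExists {E : Type*} [NormedAddCommGroup E] [NormedSpace ℝ E]
    {f : Space → E} (hf : LocallyIntegrable f volume) (n : ℕ) :
    ConvolutionExists ((mollifier n).normed volume) f (lsmul ℝ ℝ) volume :=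
  (mollifier n).hasCompactSupport_normed.convolutionExists_left _
    (mollifier n).continuous_normed hf

theorem integrable_mollify {f : Space → ℝ} (hf : Integrable f volume) (n : ℕ) :
    Integrable (mollify n f) volume :=
  (mollifier n).integrable_normed.integrable_convolution _ hf

theorem integral_mollify {f : Space → ℝ} (hf : Integrable f volume) (n : ℕ) :
    ∫ x, mollify n f x = ∫ x, f x := by
  unfold mollify
  rw [integral_convolution _ (mollifier n).integrable_normed hf, ContDiffBump.integral_normed]
  simp

/-- The inequality `2 c |f(y)| ≤ c² + |f(y)|²`, averaged against the mollifier. With `c = |f(x)|` it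
bounds `|f| |ρ_n ⋆ f|` by functions that converge in `L¹`. -/
theorem two_mul_norm_mul_mollify_le {f : Space → ℂ} (hf : LocallyIntegrable f volume)
    (hf2 : Integrable (fun x => ‖f x‖ ^ 2) volume) (n : ℕ) (c : ℝ) (hc : 0 ≤ c) (x : Space) :
    2 * (c * ‖mollify n f x‖) ≤ c ^ 2 + mollify n (fun x => ‖f x‖ ^ 2) x := by
  have h1 : Integrable (fun t => (mollifier n).normed volume t * ‖f (x - t)‖) := by
    have := (mollify_convolutionExists hf n x).norm
    refine this.congr (Eventually.of_forall fun t => ?_)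
    simp [abs_of_nonneg ((mollifier n).nonneg_normed (μ := volume) t)]
  have h2 : Integrable (fun t => (mollifier n).normed volume t * ‖f (x - t)‖ ^ 2) :=
    mollify_convolutionExists hf2.locallyIntegrable n x
  have h3 : Integrable ((mollifier n).normed volume) := (mollifier n).integrable_normed
  have h4 : ‖mollify n f x‖ ≤ ∫ t, (mollifier n).normed volume t * ‖f (x - t)‖ := by
    refine (norm_integral_le_integral_norm _).trans (le_of_eq ?_)
    refine integral_congr_ae (Eventually.of_forall fun t => ?_)
    simp [abs_of_nonneg ((mollifier n).nonneg_normed (μ := volume) t)]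
  have h5 : c ^ 2 + mollify n (fun x => ‖f x‖ ^ 2) x
      = ∫ t, ((mollifier n).normed volume t * c ^ 2
          + (mollifier n).normed volume t * ‖f (x - t)‖ ^ 2) := by
    rw [integral_add (h3.mul_const _) h2, integral_mul_const, ContDiffBump.integral_normed,
      one_mul]
    rfl
  calc 2 * (c * ‖mollify n f x‖)
      ≤ 2 * c * ∫ t, (mollifier n).normed volume t * ‖f (x - t)‖ := by
        rw [← mul_assoc]; gcongr
    _ = ∫ t, 2 * c * ((mollifier n).normed volume t * ‖f (x - t)‖) := by
        rw [integral_const_mul]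
    _ ≤ _ := by
        rw [h5]
        refine integral_mono (h1.const_mul _) ((h3.mul_const _).add h2) fun t => ?_
        have := mul_nonneg ((mollifier n).nonneg_normed (μ := volume) t)
          (sq_nonneg (c - ‖f (x - t)‖))
        simp only
        linarith

/-- Mollification turns weak derivatives into classical ones, because the translated and reflected
mollifiers `ρ_n(x - ·)` are test functions. -/
theorem partialDeriv_mollify {u : Space → ℂ} {g : Space → EuclideanSpace ℂ (Fin 3)}
    (hu : LocallyIntegrable u volume) (hg : IsWeakGradient u g) (n : ℕ) (j : Fin 3) (x : Space) :
    partialDeriv j (mollify n u) x = mollify n (fun y => g y j) x := by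
  set ρ := (mollifier n).normed (volume : Measure Space) with hρ
  have hρs : ContDiff ℝ ((⊤ : ℕ∞) : WithTop ℕ∞) ρ := (mollifier n).contDiff_normed
  have hρd : Differentiable ℝ ρ := hρs.differentiable (by simp)
  have hρc : HasCompactSupport ρ := (mollifier n).hasCompactSupport_normed
  have hD := hρc.hasFDerivAt_convolution_left (lsmul ℝ ℝ) (hρs.of_le (by simp)) hu x
  have hη : IsTestFunction (fun t => ((ρ (x - t) : ℝ) : ℂ)) := by
    refine ⟨Complex.ofRealCLM.contDiff.comp (hρs.comp (contDiff_const.sub contDiff_id)), ?_⟩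
    have h1 : HasCompactSupport (fun t => ρ (x - t)) :=
      hρc.comp_homeomorph (Homeomorph.subLeft x)
    exact h1.comp_left (g := ((↑) : ℝ → ℂ)) (by simp)
  have hpd : ∀ t, partialDeriv j (fun t => ((ρ (x - t) : ℝ) : ℂ)) t
      = -((fderiv ℝ ρ (x - t) (EuclideanSpace.single j 1) : ℝ) : ℂ) := by
    intro t
    have h1 : HasFDerivAt (fun t => x - t) (-(ContinuousLinearMap.id ℝ Space)) t :=
      (hasFDerivAt_id t).const_sub x
    have h2 := (hρd (x - t)).hasFDerivAt.comp t h1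
    have h3 := Complex.ofRealCLM.hasFDerivAt.comp t h2
    unfold partialDeriv
    have h4 : (fun t => ((ρ (x - t) : ℝ) : ℂ)) = Complex.ofRealCLM ∘ ρ ∘ fun t => x - t := rfl
    rw [h4, h3.fderiv]
    simp
  have key := hg.2 _ hη j
  simp_rw [hpd] at key
  have e1 : partialDeriv j (mollify n u) x
      = ∫ t, ((fderiv ℝ ρ (x - t) (EuclideanSpace.single j 1) : ℝ) : ℂ) * u t := by
    unfold partialDeriv mollify
    rw [hD.fderiv, convolution_eq_swap]
    rw [ContinuousLinearMap.integral_apply]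
    · simp [ContinuousLinearMap.precompL_apply]
    · have := (hρc.fderiv ℝ).convolutionExists_left (precompL Space (lsmul ℝ ℝ))
        (hρs.continuous_fderiv (by simp)) hu x
      exact this.integrable_swap
  have e2 : mollify n (fun y => g y j) x = ∫ t, g t j * ((ρ (x - t) : ℝ) : ℂ) := by
    unfold mollify
    rw [convolution_eq_swap]
    simp [hρ, mul_comm]
  rw [e1, e2]
  rw [← neg_inj, ← key, ← integral_neg]
  congr 1
  ext t
  ring

/-! ### Testing the equation with truncations of the solution -/

theorem memLp_coord {g : Space → EuclideanSpace ℂ (Fin 3)} (hg : MemLp g 2 volume) (j : Fin 3) :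
    MemLp (fun x => g x j) 2 volume :=
  (EuclideanSpace.proj (𝕜 := ℂ) j).comp_memLp' hg

theorem IsTestFunction.partialDeriv {η : Space → ℂ} (h : IsTestFunction η) (j : Fin 3) :
    Continuous (partialDeriv j η) ∧ HasCompactSupport (Charges.partialDeriv j η) := by
  refine ⟨(h.1.continuous_fderiv (by simp)).clm_apply continuous_const, ?_⟩
  exact (h.2.fderiv ℝ).comp_left (g := fun L : Space →L[ℝ] ℂ => L (EuclideanSpace.single j 1)) rfl

theorem partialDeriv_mul_comp {X v : Space → ℂ} {S : ℂ → ℂ} (hX : Differentiable ℝ X)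
    (hv : Differentiable ℝ v) (hS : Differentiable ℝ S) (j : Fin 3) (x : Space) :
    partialDeriv j (fun y => X y * S (v y)) x =
      partialDeriv j X x * S (v x) + X x * fderiv ℝ S (v x) (partialDeriv j v x) := by
  have h1 := (hS (v x)).hasFDerivAt.comp x (hv x).hasFDerivAt
  have h2 := (hX x).hasFDerivAt.mul h1
  unfold partialDeriv
  have h3 : (fun y => X y * S (v y)) = X * (S ∘ v) := rfl
  rw [h3, h2.fderiv]
  simp
  ring

/-- If `F = -κ Δu` in the sense of distributions, with `F` locally integrable and `∇u = g` in `L²`,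
then the equation may be tested with `X S(u)`, for `X` a test function and `S` smooth with compact
support in `ℂ`. The functions `X S(ρ_n ⋆ u)` are honest test functions, bounded uniformly in `n`, so
no chain rule for weak derivatives is needed. -/
theorem integral_mul_comp_eq {κ : ℂ} {u F : Space → ℂ}
    {g : Space → EuclideanSpace ℂ (Fin 3)} (hu : LocallyIntegrable u volume)
    (hg : IsWeakGradient u g) (hF : LocallyIntegrable F volume)
    (heq : ∀ η : Space → ℂ, IsTestFunction η →
      ∫ x, F x * η x = κ * ∑ j : Fin 3, ∫ x, g x j * partialDeriv j η x)
    {X : Space → ℂ} (hX : IsTestFunction X) {S : ℂ → ℂ}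
    (hS : ContDiff ℝ ((⊤ : ℕ∞) : WithTop ℕ∞) S) (hSc : HasCompactSupport S) :
    ∫ x, F x * (X x * S (u x)) = κ * ∑ j : Fin 3,
      ∫ x, g x j * (partialDeriv j X x * S (u x) + X x * fderiv ℝ S (u x) (g x j)) := by
  obtain ⟨A, hA⟩ := hX.2.exists_bound_of_continuous hX.1.continuous
  obtain ⟨B, hB⟩ := hSc.exists_bound_of_continuous hS.continuous
  obtain ⟨D, hD⟩ := (hSc.fderiv ℝ).exists_bound_of_continuous (hS.continuous_fderiv (by simp))
  have hA0 : 0 ≤ A := (norm_nonneg _).trans (hA 0)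
  have hD0 : 0 ≤ D := (norm_nonneg _).trans (hD 0)
  have hlimu := ae_tendsto_mollify hu
  have hvc : ∀ n, ContDiff ℝ ((⊤ : ℕ∞) : WithTop ℕ∞) (mollify n u) := contDiff_mollify hu
  have hη : ∀ n, IsTestFunction (fun x => X x * S (mollify n u x)) := fun n =>
    ⟨hX.1.mul (hS.comp (hvc n)), hX.2.mul_right⟩
  have hleft : Tendsto (fun n => ∫ x, F x * (X x * S (mollify n u x))) atTop
      (𝓝 (∫ x, F x * (X x * S (u x)))) := by
    have hFX : Integrable (fun x => F x * X x) :=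
      hF.integrable_smul_right_of_hasCompactSupport hX.1.continuous hX.2
    refine tendsto_integral_of_dominated_convergence (fun x => ‖F x * X x‖ * B)
      (fun n => hF.aestronglyMeasurable.mul (hη n).1.continuous.aestronglyMeasurable)
      (hFX.norm.mul_const B) (fun n => Eventually.of_forall fun x => ?_) ?_
    · rw [← mul_assoc, norm_mul]
      exact mul_le_mul_of_nonneg_left (hB _) (norm_nonneg _)
    · filter_upwards [hlimu] with x hx
      exact (((hS.continuous.tendsto _).comp hx).const_mul _).const_mul _
  have hright : ∀ j : Fin 3,
      Tendsto (fun n => ∫ x, g x j * partialDeriv j (fun y => X y * S (mollify n u y)) x) atTop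
        (𝓝 (∫ x, g x j * (partialDeriv j X x * S (u x) + X x * fderiv ℝ S (u x) (g x j)))) := by
    intro j
    have hgj := memLp_coord hg.1 j
    have hgl : LocallyIntegrable (fun x => g x j) volume := hgj.locallyIntegrable (by norm_num)
    have hg2 : Integrable (fun x => ‖g x j‖ ^ 2) volume := hgj.integrable_norm_pow (by norm_num)
    have hgX : Integrable (fun x => ‖g x j‖ * ‖partialDeriv j X x‖) := by
      have : Integrable (fun x => g x j * partialDeriv j X x) :=
        hgl.integrable_smul_right_of_hasCompactSupport (hX.partialDeriv j).1 (hX.partialDeriv j).2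
      simpa only [norm_mul] using this.norm
    have hpd : ∀ n x, partialDeriv j (fun y => X y * S (mollify n u y)) x =
        partialDeriv j X x * S (mollify n u x) +
          X x * fderiv ℝ S (mollify n u x) (mollify n (fun y => g y j) x) := by
      intro n x
      rw [partialDeriv_mul_comp (hX.1.differentiable (by simp)) ((hvc n).differentiable (by simp))
        (hS.differentiable (by simp)), partialDeriv_mollify hu hg]
    have hGi : ∀ h : Space → ℝ, Integrable h volume → Integrable (fun x =>
        B * (‖g x j‖ * ‖partialDeriv j X x‖) + A * D / 2 * (‖g x j‖ ^ 2 + h x)) volume :=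
      fun h hh => (hgX.const_mul B).add ((hg2.add hh).const_mul _)
    have hGe : ∀ h : Space → ℝ, Integrable h volume → ∫ x,
        (B * (‖g x j‖ * ‖partialDeriv j X x‖) + A * D / 2 * (‖g x j‖ ^ 2 + h x)) =
        B * (∫ x, ‖g x j‖ * ‖partialDeriv j X x‖) +
          A * D / 2 * ((∫ x, ‖g x j‖ ^ 2) + ∫ x, h x) := by
      intro h hh
      have hs : Integrable (fun x => ‖g x j‖ ^ 2 + h x) := hg2.add hh
      rw [integral_add (hgX.const_mul B) (hs.const_mul _), integral_const_mul,
        integral_const_mul, integral_add hg2 hh]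
    -- The gradient term is dominated through `|g_j| |ρ_n ⋆ g_j| ≤ (|g_j|² + ρ_n ⋆ |g_j|²) / 2`,
    -- and mollification preserves the integral of `|g_j|²`.
    refine tendsto_integral_of_tendsto_dominated (G := fun n x =>
        B * (‖g x j‖ * ‖partialDeriv j X x‖) +
          A * D / 2 * (‖g x j‖ ^ 2 + mollify n (fun y => ‖g y j‖ ^ 2) x))
      (G' := fun x => B * (‖g x j‖ * ‖partialDeriv j X x‖) +
        A * D / 2 * (‖g x j‖ ^ 2 + ‖g x j‖ ^ 2)) (fun n => ?_)
      (fun n => hGi _ (integrable_mollify hg2 n)) (hGi _ hg2)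
      (fun n => Eventually.of_forall fun x => ?_) ?_ ?_ ?_
    · exact hgl.aestronglyMeasurable.mul ((hη n).partialDeriv j).1.aestronglyMeasurable
    · rw [hpd, norm_mul]
      have h1 := two_mul_norm_mul_mollify_le hgl hg2 n ‖g x j‖ (norm_nonneg _) x
      have h2 : ‖X x * fderiv ℝ S (mollify n u x) (mollify n (fun y => g y j) x)‖
          ≤ A * (D * ‖mollify n (fun y => g y j) x‖) := by
        rw [norm_mul]
        exact mul_le_mul (hA x) (le_of_opNorm_le _ (hD _) _) (norm_nonneg _) hA0
      have h3 : ‖partialDeriv j X x * S (mollify n u x)‖ ≤ ‖partialDeriv j X x‖ * B := by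
        rw [norm_mul]
        exact mul_le_mul_of_nonneg_left (hB _) (norm_nonneg _)
      calc _ ≤ ‖g x j‖ * (‖partialDeriv j X x‖ * B +
              A * (D * ‖mollify n (fun y => g y j) x‖)) :=
            mul_le_mul_of_nonneg_left ((norm_add_le _ _).trans (add_le_add h3 h2)) (norm_nonneg _)
        _ = B * (‖g x j‖ * ‖partialDeriv j X x‖) +
              A * D / 2 * (2 * (‖g x j‖ * ‖mollify n (fun y => g y j) x‖)) := by ring
        _ ≤ _ := by gcongr
    · filter_upwards [hlimu, ae_tendsto_mollify hgl] with x hx hx'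
      simp_rw [hpd]
      refine (Tendsto.add (((hS.continuous.tendsto _).comp hx).const_mul _)
        (Tendsto.const_mul _ ?_)).const_mul _
      have hx2 : Tendsto (fun n => fderiv ℝ S (mollify n u x)) atTop (𝓝 (fderiv ℝ S (u x))) :=
        ((hS.continuous_fderiv (by simp)).tendsto _).comp hx
      exact (isBoundedBilinearMap_apply.continuous.tendsto _).comp (hx2.prodMk_nhds hx')
    · filter_upwards [ae_tendsto_mollify hg2.locallyIntegrable] with x hx
      exact ((hx.const_add _).const_mul _).const_add _
    · simp_rw [fun n => hGe _ (integrable_mollify hg2 n), hGe _ hg2, integral_mollify hg2]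
      exact tendsto_const_nhds
  refine tendsto_nhds_unique hleft ?_
  simp_rw [fun n => heq _ (hη n)]
  exact (tendsto_finsetSum _ fun j _ => hright j).const_mul κ

/-! ### Testing the equation with the conjugate of the solution -/

/-- A cutoff equal to `1` on the unit ball and supported in the ball of radius `2`. -/
noncomputable def cutoff (E : Type*) [NormedAddCommGroup E] : ContDiffBump (0 : E) :=
  ⟨1, 2, one_pos, one_lt_two⟩

/-- A smooth, compactly supported function `ℂ → ℂ` that is complex conjugation near `0`. -/
noncomputable def truncConj (w : ℂ) : ℂ := (cutoff ℂ w : ℂ) * (starRingEnd ℂ) w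

theorem contDiff_truncConj : ContDiff ℝ ((⊤ : ℕ∞) : WithTop ℕ∞) truncConj :=
  (Complex.ofRealCLM.contDiff.comp (cutoff ℂ).contDiff).mul Complex.conjCLE.contDiff

theorem hasCompactSupport_truncConj : HasCompactSupport truncConj :=
  ((cutoff ℂ).hasCompactSupport.comp_left (g := ((↑) : ℝ → ℂ)) (by simp)).mul_right

theorem norm_truncConj_le (w : ℂ) : ‖truncConj w‖ ≤ ‖w‖ := by
  unfold truncConj
  rw [norm_mul, Complex.norm_real, Complex.norm_conj, Real.norm_of_nonneg (cutoff ℂ).nonneg]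
  exact mul_le_of_le_one_left (norm_nonneg _) (cutoff ℂ).le_one

theorem truncConj_eventuallyEq {w : ℂ} (hw : ‖w‖ < 1) :
    truncConj =ᶠ[𝓝 w] (starRingEnd ℂ) := by
  filter_upwards [(continuous_norm.tendsto w).eventually (gt_mem_nhds hw)] with z hz
  unfold truncConj
  rw [(cutoff ℂ).one_of_mem_closedBall (by simpa [cutoff] using hz.le)]
  simp

theorem fderiv_truncConj {w : ℂ} (hw : ‖w‖ < 1) (h : ℂ) :
    fderiv ℝ truncConj w h = (starRingEnd ℂ) h := by
  rw [(truncConj_eventuallyEq hw).fderiv_eq]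
  exact congrArg (fun L : ℂ →L[ℝ] ℂ => L h) (Complex.conjCLE.fderiv (x := w))

/-- If `F = -κ Δu` in the sense of distributions, `u` is in `H¹` with gradient `g`, and `F` is
locally integrable with `F conj(u)` integrable, then the equation may be tested with `conj u`. -/
theorem integral_mul_conj_eq {κ : ℂ} {u F : Space → ℂ}
    {g : Space → EuclideanSpace ℂ (Fin 3)} (hu : MemLp u 2 volume)
    (hg : IsWeakGradient u g) (hF : LocallyIntegrable F volume)
    (hFu : Integrable (fun x => F x * (starRingEnd ℂ) (u x)) volume)
    (heq : ∀ η : Space → ℂ, IsTestFunction η →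
      ∫ x, F x * η x = κ * ∑ j : Fin 3, ∫ x, g x j * partialDeriv j η x) :
    ∫ x, F x * (starRingEnd ℂ) (u x) = κ * ((∫ x, ‖g x‖ ^ 2 : ℝ) : ℂ) := by
  have hul : LocallyIntegrable u volume := hu.locallyIntegrable (by norm_num)
  set c : ℕ → ℝ := fun n => (n : ℝ) + 1 with hc
  have hc0 : ∀ n, 0 < c n := fun n => by positivity
  have hc1 : ∀ n, (c n)⁻¹ ≤ 1 := fun n => inv_le_one_of_one_le₀ (by simp [hc])
  have hclim : Tendsto (fun n => (c n)⁻¹) atTop (𝓝 0) :=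
    tendsto_inv_atTop_zero.comp (tendsto_natCast_atTop_atTop.atTop_add tendsto_const_nhds)
  have hsmall : ∀ {E : Type} [NormedAddCommGroup E] [NormedSpace ℝ E] (z : E),
      ∀ᶠ n in atTop, ‖(c n)⁻¹ • z‖ < 1 := by
    intro E _ _ z
    have : Tendsto (fun n => ‖(c n)⁻¹ • z‖) atTop (𝓝 0) := by
      simpa using (hclim.smul_const z).norm
    exact this.eventually (gt_mem_nhds one_pos)
  -- The spatial cutoffs `X n = X₁(x / c n)` tend to `1`, and their gradients tend to `0` uniformly.
  set X₁ : Space → ℂ := fun x => ((cutoff Space x : ℝ) : ℂ) with hX₁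
  have hX₁t : IsTestFunction X₁ := ⟨Complex.ofRealCLM.contDiff.comp (cutoff Space).contDiff,
    (cutoff Space).hasCompactSupport.comp_left (g := ((↑) : ℝ → ℂ)) (by simp)⟩
  set X : ℕ → Space → ℂ := fun n x => X₁ ((c n)⁻¹ • x) with hXdef
  have hXt : ∀ n, IsTestFunction (X n) := fun n =>
    ⟨hX₁t.1.comp (contDiff_const_smul _), hX₁t.2.comp_smul (inv_ne_zero (hc0 n).ne')⟩
  have hX1 : ∀ n x, ‖X n x‖ ≤ 1 := fun n x => by
    rw [hXdef, hX₁]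
    simp only [Complex.norm_real]
    rw [Real.norm_of_nonneg (cutoff Space).nonneg]
    exact (cutoff Space).le_one
  have hXlim : ∀ x, Tendsto (fun n => X n x) atTop (𝓝 1) := fun x => by
    refine tendsto_const_nhds.congr' ?_
    filter_upwards [hsmall x] with n hn
    rw [hXdef, hX₁]
    simp only
    rw [(cutoff Space).one_of_mem_closedBall (by simpa [cutoff, norm_smul] using hn.le)]
    simp
  have hXd : ∀ j n x, partialDeriv j (X n) x =
      (((c n)⁻¹ : ℝ) : ℂ) * partialDeriv j X₁ ((c n)⁻¹ • x) := fun j n x => by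
    unfold partialDeriv
    rw [hXdef]
    simp only
    rw [fderiv_comp_smul]
    simp
  -- The truncations `S n w = c n • truncConj (w / c n)` tend to conjugation and satisfy
  -- `‖S n w‖ ≤ ‖w‖`; by scaling, their derivatives are bounded uniformly in `n`.
  set S : ℕ → ℂ → ℂ := fun n w => c n • truncConj ((c n)⁻¹ • w) with hSdef
  have hS : ∀ n, ContDiff ℝ ((⊤ : ℕ∞) : WithTop ℕ∞) (S n) := fun n =>
    (contDiff_truncConj.comp (contDiff_const_smul _)).const_smul _
  have hSc : ∀ n, HasCompactSupport (S n) := fun n =>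
    (hasCompactSupport_truncConj.comp_smul (inv_ne_zero (hc0 n).ne')).smul_left
      (f := fun _ => c n)
  have hSd : ∀ n w h, fderiv ℝ (S n) w h = fderiv ℝ truncConj ((c n)⁻¹ • w) h := fun n w h => by
    rw [hSdef]
    simp only
    rw [fderiv_fun_const_smul, fderiv_comp_smul]
    · simp [smul_smul, (hc0 n).ne']
    · exact ((contDiff_truncConj.comp (contDiff_const_smul _)).differentiable
        (n := ((⊤ : ℕ∞) : WithTop ℕ∞)) (by simp)) w
  have hSle : ∀ n w, ‖S n w‖ ≤ ‖w‖ := fun n w => by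
    rw [hSdef]
    simp only [norm_smul, Real.norm_of_nonneg (hc0 n).le]
    refine (mul_le_mul_of_nonneg_left (norm_truncConj_le _) (hc0 n).le).trans (le_of_eq ?_)
    rw [norm_smul, Real.norm_of_nonneg (inv_nonneg.2 (hc0 n).le),
      mul_inv_cancel_left₀ (hc0 n).ne']
  have hSlim : ∀ w, Tendsto (fun n => S n w) atTop (𝓝 ((starRingEnd ℂ) w)) := fun w => by
    refine tendsto_const_nhds.congr' ?_
    filter_upwards [hsmall w] with n hn
    rw [hSdef]
    simp only
    rw [(truncConj_eventuallyEq hn).eq_of_nhds]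
    simp [(hc0 n).ne']
  have hSdlim : ∀ w h, Tendsto (fun n => fderiv ℝ (S n) w h) atTop (𝓝 ((starRingEnd ℂ) h)) :=
    fun w h => by
      refine tendsto_const_nhds.congr' ?_
      filter_upwards [hsmall w] with n hn
      rw [hSd, fderiv_truncConj hn]
  obtain ⟨D, hD⟩ := (hasCompactSupport_truncConj.fderiv ℝ).exists_bound_of_continuous
    (contDiff_truncConj.continuous_fderiv (by simp))
  have hid := fun n => integral_mul_comp_eq hul hg hF heq (hXt n) (hS n) (hSc n)
  have hleft : Tendsto (fun n => ∫ x, F x * (X n x * S n (u x))) atTop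
      (𝓝 (∫ x, F x * (starRingEnd ℂ) (u x))) := by
    refine tendsto_integral_of_dominated_convergence
      (fun x => ‖F x * (starRingEnd ℂ) (u x)‖) (fun n => ?_) hFu.norm
      (fun n => Eventually.of_forall fun x => ?_) (Eventually.of_forall fun x => ?_)
    · exact hF.aestronglyMeasurable.mul ((hXt n).1.continuous.aestronglyMeasurable.mul
        ((hS n).continuous.comp_aestronglyMeasurable hu.1))
    · rw [norm_mul, norm_mul, norm_mul, Complex.norm_conj]
      refine mul_le_mul_of_nonneg_left ?_ (norm_nonneg _)
      exact (mul_le_of_le_one_left (norm_nonneg _) (hX1 n x)).trans (hSle n _)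
    · simpa using ((hXlim x).mul (hSlim (u x))).const_mul (F x)
  have hright : ∀ j : Fin 3, Tendsto (fun n => ∫ x, g x j *
      (partialDeriv j (X n) x * S n (u x) + X n x * fderiv ℝ (S n) (u x) (g x j))) atTop
      (𝓝 (∫ x, ((‖g x j‖ ^ 2 : ℝ) : ℂ))) := by
    intro j
    have hgj := memLp_coord hg.1 j
    obtain ⟨M, hM⟩ := (hX₁t.partialDeriv j).2.exists_bound_of_continuous (hX₁t.partialDeriv j).1
    have hg2 : Integrable (fun x => ‖g x j‖ ^ 2) volume := hgj.integrable_norm_pow (by norm_num)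
    have hgu : Integrable (fun x => ‖g x j‖ * ‖u x‖) volume :=
      hgj.norm.integrable_mul hu.norm
    have hM0 : 0 ≤ M := (norm_nonneg _).trans (hM 0)
    have hdle : ∀ n x, ‖partialDeriv j (X n) x‖ ≤ (c n)⁻¹ * M := fun n x => by
      rw [hXd, norm_mul, Complex.norm_real, Real.norm_of_nonneg (inv_nonneg.2 (hc0 n).le)]
      exact mul_le_mul_of_nonneg_left (hM _) (inv_nonneg.2 (hc0 n).le)
    refine tendsto_integral_of_dominated_convergence
      (fun x => M * (‖g x j‖ * ‖u x‖) + D * ‖g x j‖ ^ 2) (fun n => ?_)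
      ((hgu.const_mul M).add (hg2.const_mul D))
      (fun n => Eventually.of_forall fun x => ?_) (Eventually.of_forall fun x => ?_)
    · refine hgj.1.mul (((((hXt n).partialDeriv j).1.aestronglyMeasurable).mul
        ((hS n).continuous.comp_aestronglyMeasurable hu.1)).add
        ((hXt n).1.continuous.aestronglyMeasurable.mul ?_))
      have h1 : AEStronglyMeasurable (fun x => (fderiv ℝ (S n) (u x), g x j)) volume :=
        (((hS n).continuous_fderiv (by simp)).comp_aestronglyMeasurable hu.1).prodMk hgj.1
      exact isBoundedBilinearMap_apply.continuous.comp_aestronglyMeasurable h1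
    · have h1 : ‖partialDeriv j (X n) x * S n (u x)‖ ≤ M * ‖u x‖ := by
        rw [norm_mul]
        exact mul_le_mul ((hdle n x).trans (mul_le_of_le_one_left hM0 (hc1 n))) (hSle n _)
          (norm_nonneg _) hM0
      have h2 : ‖X n x * fderiv ℝ (S n) (u x) (g x j)‖ ≤ D * ‖g x j‖ := by
        rw [norm_mul, hSd]
        exact (mul_le_of_le_one_left (norm_nonneg _) (hX1 n x)).trans
          (le_of_opNorm_le _ (hD _) _)
      rw [norm_mul]
      calc _ ≤ ‖g x j‖ * (M * ‖u x‖ + D * ‖g x j‖) :=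
            mul_le_mul_of_nonneg_left ((norm_add_le _ _).trans (add_le_add h1 h2)) (norm_nonneg _)
        _ = _ := by ring
    · have h1 : Tendsto (fun n => partialDeriv j (X n) x) atTop (𝓝 0) := by
        refine squeeze_zero_norm (fun n => hdle n x) ?_
        simpa using hclim.mul_const M
      have h2 := ((h1.mul (hSlim (u x))).add ((hXlim x).mul (hSdlim (u x) (g x j)))).const_mul
        (g x j)
      have h3 : g x j * (0 * (starRingEnd ℂ) (u x) + 1 * (starRingEnd ℂ) (g x j)) =
          ((‖g x j‖ ^ 2 : ℝ) : ℂ) := by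
        rw [zero_mul, zero_add, one_mul, Complex.mul_conj, Complex.normSq_eq_norm_sq]
      rwa [h3] at h2
  have hsum : ((∫ x, ‖g x‖ ^ 2 : ℝ) : ℂ) = ∑ j : Fin 3, ∫ x, ((‖g x j‖ ^ 2 : ℝ) : ℂ) := by
    simp_rw [integral_complex_ofReal, EuclideanSpace.norm_sq_eq]
    rw [integral_finsetSum _ fun j _ => (memLp_coord hg.1 j).integrable_norm_pow (by norm_num)]
    push_cast
    rfl
  rw [hsum]
  refine tendsto_nhds_unique hleft ?_
  simp_rw [hid]
  exact (tendsto_finsetSum _ fun j _ => hright j).const_mul κ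

/-! ### Local integrability of the potentials -/

/-- The kernel `1 / |z|` is the sum of `K₁`, its integrable part in the unit ball, and `K₂`, its
bounded part outside; both have locally integrable convolutions with the integrable `|ψ|²`. -/
theorem locallyIntegrable_potential (q : ℝ) {ψ : Space → ℂ}
    (hψ : Integrable (fun x => ‖ψ x‖ ^ 2) volume) : LocallyIntegrable (potential q ψ) volume := by
  set f : Space → ℝ := fun x => ‖ψ x‖ ^ 2 with hf
  set K₁ : Space → ℝ := (Metric.ball 0 1).indicator fun z => ‖z‖⁻¹ with hK₁
  set K₂ : Space → ℝ := (Metric.ball 0 1)ᶜ.indicator fun z => ‖z‖⁻¹ with hK₂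
  have hinv : Measurable fun z : Space => ‖z‖⁻¹ := measurable_norm.inv
  have hK₁i : Integrable K₁ volume := by
    rw [hK₁, integrable_indicator_iff Metric.isOpen_ball.measurableSet]
    refine integrableOn_ball_of_norm_le_rpow (C := 1) (α := 1) (by simp) (by simp)
      (Eventually.of_forall fun z => ?_) hinv.aestronglyMeasurable
    rw [Real.rpow_neg_one]
    simp
  have hK₂m : AEStronglyMeasurable K₂ volume :=
    (hinv.indicator Metric.isOpen_ball.measurableSet.compl).aestronglyMeasurable
  have hK₂b : ∀ z, ‖K₂ z‖ ≤ 1 := fun z => by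
    by_cases hz : z ∈ (Metric.ball (0 : Space) 1)ᶜ
    · rw [hK₂, Set.indicator_of_mem hz]
      have : 1 ≤ ‖z‖ := by simpa using hz
      simpa using inv_le_one_of_one_le₀ this
    · rw [hK₂, Set.indicator_of_notMem hz]
      simp
  have hex₂ : ∀ x, Integrable (fun y => f y * K₂ (x - y)) volume := fun x => by
    refine hψ.mul_bdd (c := 1) ?_ (Eventually.of_forall fun y => hK₂b _)
    exact hK₂m.comp_quasiMeasurePreserving
      (quasiMeasurePreserving_sub_left_of_right_invariant volume x)
  have h₁ : LocallyIntegrable (f ⋆[mul ℝ ℝ, volume] K₁) volume :=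
    (hψ.integrable_convolution _ hK₁i).locallyIntegrable
  have h₂ : LocallyIntegrable (f ⋆[mul ℝ ℝ, volume] K₂) volume := by
    refine (locallyIntegrable_const (∫ y, f y)).mono
      (hψ.aestronglyMeasurable.convolution_integrand (mul ℝ ℝ) hK₂m).integral_prod_right'
      (Eventually.of_forall fun x => ?_)
    refine (norm_integral_le_integral_norm _).trans ((integral_mono (hex₂ x).norm hψ fun y => ?_).trans
      (Real.le_norm_self _))
    simp only [norm_mul]
    rw [hf]
    simp only [norm_pow, norm_norm]
    exact mul_le_of_le_one_right (by positivity) (hK₂b _)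
  -- The identity is only almost everywhere: the convolution with `K₁` need not exist at every point.
  have heq : potential q ψ =ᵐ[volume]
      fun x => q * ((f ⋆[mul ℝ ℝ, volume] K₁) x + (f ⋆[mul ℝ ℝ, volume] K₂) x) := by
    filter_upwards [hψ.ae_convolution_exists (mul ℝ ℝ) hK₁i] with x hx
    unfold potential
    have hx' : Integrable (fun y => f y * K₁ (x - y)) volume := hx
    rw [convolution_mul, convolution_mul, ← integral_add hx' (hex₂ x)]
    congr 2
    ext y
    rw [← mul_add, ← Pi.add_apply (f := K₁), hK₁, hK₂, Set.indicator_self_add_compl,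
      norm_sub_rev, div_eq_mul_inv]
  exact ((h₁.add h₂).smul q).congr heq.symm

theorem locallyIntegrable_otherPotential {N : ℕ} (q : Fin N → ℝ) {ψ : Fin N → Space → ℂ}
    (hψ : ∀ l, Integrable (fun x => ‖ψ l x‖ ^ 2) volume) (l : Fin N) :
    LocallyIntegrable (otherPotential q ψ l) volume :=
  locallyIntegrable_finsetSum _ fun k _ => locallyIntegrable_potential (q k) (hψ k)

/-! ### The logarithmic nonlinearity -/

theorem logG'_eq {a s : ℝ} (ha : 0 < a) (hs : 0 < s) :
    logG' a s = -(a ^ 2)⁻¹ * Real.log s + logG' a 1 := by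
  have hC : 0 < gaussConst := Real.rpow_pos_of_pos Real.pi_pos _
  unfold logG'
  rw [mul_one, mul_div_right_comm, Real.log_mul (by positivity) hs.ne']
  ring

/-- The identity `s G'(s) = G(s) - s / a²`: the constant in the relation between frequency and energy
comes from its last term. -/
theorem logG_eq_logG'_mul {a s : ℝ} (ha : 0 < a) (hs : 0 ≤ s) :
    logG a s = logG' a s * s + (a ^ 2)⁻¹ * s := by
  have hpi := Real.pi_pos
  have hC : gaussConst ^ 2 = (Real.pi ^ (3 / 2 : ℝ))⁻¹ := by
    unfold gaussConst
    rw [← Real.rpow_natCast, ← Real.rpow_mul hpi.le, ← Real.rpow_neg hpi.le]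
    norm_num
  have hP : 0 < Real.pi ^ (3 / 2 : ℝ) := Real.rpow_pos_of_pos hpi _
  rcases hs.eq_or_lt with rfl | hs
  · simp [logG]
  · rw [logG_eq ha s hs.le, logG'_eq ha hs]
    unfold logG'
    rw [hC, div_inv_eq_mul, mul_one, Real.log_mul (by positivity) hP.ne', Real.log_pow, one_div,
      Real.log_inv]
    push_cast
    ring

/-- With `r = |ψ|`: `G'(|ψ|²) ψ` is locally integrable as soon as `G'(|ψ|²) |ψ|²` is integrable,
because `r log r` is bounded on the unit interval. -/
theorem exists_abs_logG'_sq_mul_le {a : ℝ} (ha : 0 < a) :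
    ∃ C : ℝ, ∀ r : ℝ, 0 ≤ r →
      |logG' a (r ^ 2)| * r ≤ C + |logG' a (r ^ 2) * r ^ 2| := by
  refine ⟨2 * (a ^ 2)⁻¹ + |logG' a 1|, fun r hr => ?_⟩
  have hC : 0 ≤ 2 * (a ^ 2)⁻¹ + |logG' a 1| := by positivity
  rw [abs_mul, abs_of_nonneg (sq_nonneg r)]
  rcases hr.eq_or_lt with rfl | hr0
  · simpa using hC
  rcases le_total r 1 with h1 | h1
  · have hlog := (Real.abs_log_mul_self_lt r hr0 h1).le
    rw [abs_mul, abs_of_pos hr0] at hlog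
    have hb : |logG' a (r ^ 2)| ≤ 2 * (a ^ 2)⁻¹ * |Real.log r| + |logG' a 1| := by
      rw [logG'_eq ha (by positivity), Real.log_pow]
      refine (abs_add_le _ _).trans (le_of_eq ?_)
      rw [abs_mul, abs_neg, abs_of_pos (by positivity : 0 < (a ^ 2)⁻¹)]
      push_cast
      rw [abs_mul, abs_two]
      ring
    calc |logG' a (r ^ 2)| * r
        ≤ (2 * (a ^ 2)⁻¹ * |Real.log r| + |logG' a 1|) * r := by gcongr
      _ = 2 * (a ^ 2)⁻¹ * (|Real.log r| * r) + |logG' a 1| * r := by ring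
      _ ≤ 2 * (a ^ 2)⁻¹ * 1 + |logG' a 1| * 1 := by gcongr
      _ ≤ _ := by
        rw [mul_one, mul_one]
        exact le_add_of_nonneg_right (by positivity)
  · have : r ≤ r ^ 2 := by nlinarith
    have := mul_le_mul_of_nonneg_left this (abs_nonneg (logG' a (r ^ 2)))
    linarith

theorem locallyIntegrable_ofReal_mul {u : Space → ℂ} {V H : Space → ℝ}
    (hu : AEStronglyMeasurable u volume) (hV : AEStronglyMeasurable V volume)
    (hH : LocallyIntegrable H volume) (hVu : Integrable (fun x => V x * ‖u x‖ ^ 2) volume)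
    (hle : ∀ x, |V x| * ‖u x‖ ≤ H x + |V x * ‖u x‖ ^ 2|) :
    LocallyIntegrable (fun x => (V x : ℂ) * u x) volume := by
  refine (hH.add hVu.abs.locallyIntegrable).mono
    ((Complex.continuous_ofReal.comp_aestronglyMeasurable hV).mul hu)
    (Eventually.of_forall fun x => ?_)
  rw [norm_mul, Complex.norm_real]
  exact (hle x).trans (le_abs_self _)

/-! ### The relation between frequency and energy -/

/-- The `ℓ`-th equation, tested with `conj ψ_ℓ`, gives
`χ ω_ℓ = ∫ q_ℓ φ_{≠ℓ} |ψ_ℓ|² + κ ∫ (|∇ψ_ℓ|² + G'(|ψ_ℓ|²) |ψ_ℓ|²)` with `κ = χ² / (2 m_ℓ)`, and the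
identity `s G'(s) = G(s) - s / a²` turns the right side into the energy minus `κ / a_ℓ²`. -/
theorem IsMultiharmonicSolution.frequency_sub_energy {N : ℕ} {χ : ℝ} (hχ : 0 < χ)
    {m q a : Fin N → ℝ} (hm : ∀ l, 0 < m l) (ha : ∀ l, 0 < a l) {ψ : Fin N → Space → ℂ}
    {ω : Fin N → ℝ} (hψ : IsMultiharmonicSolution χ m q a ψ ω) (l : Fin N)
    (hE : HasFiniteEnergy χ m q a ψ l) :
    χ * ω l - particleEnergy χ m q a ψ l = -(χ ^ 2 / (2 * a l ^ 2 * m l)) := by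
  obtain ⟨hE1, hE2⟩ := hE
  obtain ⟨⟨hu, hex⟩, hnorm⟩ := hψ.memXi l
  have hal := ha l
  have hml := hm l
  set κ : ℝ := χ ^ 2 / (2 * m l) with hκ
  have hκ0 : 0 < κ := by positivity
  set u := ψ l with hudef
  set g := weakGradient u with hgdef
  have hg : IsWeakGradient u g := by
    rw [hgdef, weakGradient, dif_pos hex]
    exact hex.choose_spec
  have hu2 : Integrable (fun x => ‖u x‖ ^ 2) volume := hu.integrable_norm_pow (by norm_num)
  have hg2 : Integrable (fun x => ‖g x‖ ^ 2) volume := hg.1.integrable_norm_pow (by norm_num)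
  set V : Space → ℝ := fun x => q l * otherPotential q ψ l x with hV
  set W : Space → ℝ := fun x => κ * logG' (a l) (‖u x‖ ^ 2) with hW
  have hVl : LocallyIntegrable V volume :=
    (locallyIntegrable_otherPotential q
      (fun k => (hψ.memXi k).1.1.integrable_norm_pow (by norm_num)) l).smul (q l)
  have hVu : Integrable (fun x => V x * ‖u x‖ ^ 2) volume :=
    hE1.congr (Eventually.of_forall fun x => by simp only [hV]; ring)
  have hGu : ∀ x, κ * (‖g x‖ ^ 2 + logG (a l) (‖u x‖ ^ 2)) =
      κ * ‖g x‖ ^ 2 + W x * ‖u x‖ ^ 2 + κ * (a l ^ 2)⁻¹ * ‖u x‖ ^ 2 := fun x => by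
    rw [logG_eq_logG'_mul hal (by positivity)]
    simp only [hW]
    ring
  simp_rw [hGu] at hE2
  have hWu : Integrable (fun x => W x * ‖u x‖ ^ 2) volume := by
    refine ((hE2.sub (hg2.const_mul κ)).sub (hu2.const_mul (κ * (a l ^ 2)⁻¹))).congr
      (Eventually.of_forall fun x => ?_)
    simp only [Pi.sub_apply]
    ring
  have hWm : AEStronglyMeasurable W volume := by
    have hlog : Measurable (logG' (a l)) := by
      unfold logG'
      fun_prop
    exact ((hlog.comp_aemeasurable hu2.aemeasurable).const_mul κ).aestronglyMeasurable
  obtain ⟨C, hC⟩ := exists_abs_logG'_sq_mul_le hal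
  have hF1 : LocallyIntegrable (fun x => ((χ * ω l : ℝ) : ℂ) * u x) volume :=
    (hu.locallyIntegrable (by norm_num)).smul ((χ * ω l : ℝ) : ℂ)
  have hF2 : LocallyIntegrable (fun x => (V x : ℂ) * u x) volume := by
    refine locallyIntegrable_ofReal_mul hu.1 hVl.aestronglyMeasurable (H := fun x => |V x|)
      (hVl.mono hVl.aestronglyMeasurable.norm (Eventually.of_forall fun x => by simp)) hVu
      fun x => ?_
    rw [abs_mul (V x), abs_of_nonneg (sq_nonneg ‖u x‖)]
    have h1 : ‖u x‖ ≤ 1 + ‖u x‖ ^ 2 := by nlinarith [sq_nonneg (‖u x‖ - 1)]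
    linarith [mul_le_mul_of_nonneg_left h1 (abs_nonneg (V x))]
  have hF3 : LocallyIntegrable (fun x => (W x : ℂ) * u x) volume := by
    refine locallyIntegrable_ofReal_mul hu.1 hWm (H := fun _ => κ * C)
      (locallyIntegrable_const _) hWu fun x => ?_
    have := mul_le_mul_of_nonneg_left (hC ‖u x‖ (norm_nonneg _)) hκ0.le
    simp only [hW, abs_mul, abs_of_pos hκ0] at this ⊢
    linarith
  set F : Space → ℂ := fun x => ((χ * ω l : ℝ) : ℂ) * u x - (V x : ℂ) * u x - (W x : ℂ) * u x
    with hF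
  have hFl : LocallyIntegrable F volume := (hF1.sub hF2).sub hF3
  have hFconj : ∀ x, F x * (starRingEnd ℂ) (u x) =
      ((χ * ω l * ‖u x‖ ^ 2 - V x * ‖u x‖ ^ 2 - W x * ‖u x‖ ^ 2 : ℝ) : ℂ) := fun x => by
    have h1 : u x * (starRingEnd ℂ) (u x) = ((‖u x‖ ^ 2 : ℝ) : ℂ) := by
      rw [Complex.mul_conj, Complex.normSq_eq_norm_sq]
    push_cast at h1 ⊢
    rw [← h1]
    simp only [hF]
    push_cast
    ring
  have hint : Integrable (fun x => χ * ω l * ‖u x‖ ^ 2 - V x * ‖u x‖ ^ 2 - W x * ‖u x‖ ^ 2)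
      volume := ((hu2.const_mul (χ * ω l)).sub hVu).sub hWu
  have heq : ∀ η : Space → ℂ, IsTestFunction η →
      ∫ x, F x * η x = (κ : ℂ) * ∑ j : Fin 3, ∫ x, g x j * partialDeriv j η x := by
    intro η hη
    have hi1 : Integrable (fun x => F x * η x) volume :=
      hFl.integrable_smul_right_of_hasCompactSupport hη.1.continuous hη.2
    have hij : ∀ j ∈ Finset.univ, Integrable (fun x => g x j * partialDeriv j η x) volume :=
      fun j _ => ((memLp_coord hg.1 j).locallyIntegrable
        (by norm_num)).integrable_smul_right_of_hasCompactSupport (hη.partialDeriv j).1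
        (hη.partialDeriv j).2
    have hi2 : Integrable (fun x => (κ : ℂ) * ∑ j : Fin 3, g x j * partialDeriv j η x) volume :=
      (integrable_finsetSum _ hij).const_mul _
    have h := hψ.equation l η hη
    rw [← integral_finsetSum _ hij, ← integral_const_mul, ← sub_eq_zero, ← integral_sub hi1 hi2,
      ← h]
    refine integral_congr_ae (Eventually.of_forall fun x => ?_)
    simp only [hF]
    ring
  have hkey := integral_mul_conj_eq hu hg hFl
    (by simp_rw [hFconj]; exact hint.ofReal) heq
  simp_rw [hFconj] at hkey
  rw [integral_complex_ofReal] at hkey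
  have hkey' : ∫ x, (χ * ω l * ‖u x‖ ^ 2 - V x * ‖u x‖ ^ 2 - W x * ‖u x‖ ^ 2) =
      κ * ∫ x, ‖g x‖ ^ 2 := by exact_mod_cast hkey
  have hi12 : Integrable (fun x => χ * ω l * ‖u x‖ ^ 2 - V x * ‖u x‖ ^ 2) volume :=
    (hu2.const_mul (χ * ω l)).sub hVu
  have hi34 : Integrable (fun x => κ * ‖g x‖ ^ 2 + W x * ‖u x‖ ^ 2) volume :=
    (hg2.const_mul κ).add hWu
  rw [integral_sub hi12 hWu, integral_sub (hu2.const_mul _) hVu, integral_const_mul, hnorm,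
    mul_one] at hkey'
  have hEn : particleEnergy χ m q a ψ l = (∫ x, V x * ‖u x‖ ^ 2) +
      (κ * (∫ x, ‖g x‖ ^ 2) + (∫ x, W x * ‖u x‖ ^ 2) + κ * (a l ^ 2)⁻¹) := by
    unfold particleEnergy
    congr 1
    · refine integral_congr_ae (Eventually.of_forall fun x => ?_)
      simp only [hV]
      ring
    · rw [← hκ, ← hudef, ← hgdef]
      simp_rw [hGu]
      rw [integral_add hi34 (hu2.const_mul _), integral_add (hg2.const_mul κ) hWu,
        integral_const_mul, integral_const_mul, hnorm, mul_one]
  have hconst : χ ^ 2 / (2 * a l ^ 2 * m l) = κ * (a l ^ 2)⁻¹ := by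
    rw [hκ]
    field_simp
  rw [hEn, hconst]
  linarith

end Charges

theorem mainTheorem6 (N : ℕ) (χ : ℝ) (hχ : 0 < χ)
    (m q a : Fin N → ℝ) (hm : ∀ l, 0 < m l) (ha : ∀ l, 0 < a l)
    (ψ ψ' : Fin N → Charges.Space → ℂ) (ω ω' : Fin N → ℝ)
    (hψ : Charges.IsMultiharmonicSolution χ m q a ψ ω)
    (hψ' : Charges.IsMultiharmonicSolution χ m q a ψ' ω')
    (hE : ∀ l, Charges.HasFiniteEnergy χ m q a ψ l)
    (hE' : ∀ l, Charges.HasFiniteEnergy χ m q a ψ' l) :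
    (∀ l, χ * ω l - Charges.particleEnergy χ m q a ψ l =
        -(χ ^ 2 / (2 * a l ^ 2 * m l))) ∧
      (∀ l, χ * ω' l - Charges.particleEnergy χ m q a ψ' l =
        -(χ ^ 2 / (2 * a l ^ 2 * m l))) ∧
      ∀ l, χ * (ω l - ω' l) =
        Charges.particleEnergy χ m q a ψ l - Charges.particleEnergy χ m q a ψ' l := by
  have h := fun l => hψ.frequency_sub_energy hχ hm ha l (hE l)
  have h' := fun l => hψ'.frequency_sub_energy hχ hm ha l (hE' l)
  exact ⟨h, h', fun l => by linarith [h l, h' l]⟩
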